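/- A \emph{contextuality scenario} is a finite hypergraph $H$ with vertex set $V(H)$ and edge set $E(H) \subseteq 2^{V(H)}$ such that every vertex lies in some edge. It \emph{allows a quantum model} if there exist a nonzero complex Hilbert space $\mathcal{H}$, of finite or infinite dimension, and bounded linear operators $P_v$ on $\mathcal{H}$, for $v \in V(H)$, such that each $P_v$ is self-adjoint, $P_v^2 = P_v$ for every $v \in V(H)$, and $\sum_{v \in e} P_v = I$ for every $e \in E(H)$. Let $2$-ALLOWS-QUANTUM be the following decision problem: given a contextuality scenario $H$ all of whose edges have cardinality at most $2$ (presented by its edge-vertex incidence matrix, written row by row with an end marker after each row, the rows being the edges in any order, possibly with repetitions), does $H$ allow a quantum model? \textbf{Theorem.} $2$-ALLOWS-QUANTUM is decidable in polynomial time; that is, there are a Turing machine and a polynomial $p$ such that on every input word $w$ the machine halts after at most $p(|w|)$ steps with output yes if $w$ encodes a contextuality scenario with edges of cardinality at most $2$ that allows a quantum model, and with output no otherwise. -/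

import Mathlib

universe u v

/-- A contextuality scenario with vertex type `V`: a hypergraph, given by its set of edges, in
which every vertex lies in some edge. (Hence `V` is automatically finite.) -/
structure ContextualityScenario (V : Type v) where
  /-- the set of edges, each edge being a set of vertices -/
  edges : Finset (Finset V)
  /-- the union of the edges is the whole vertex set -/
  cover : ∀ x : V, ∃ e ∈ edges, x ∈ e

namespace ContextualityScenario

/-- `P` is a quantum model of `S` on the Hilbert space `H`: an assignment of orthogonal projection
operators to the vertices such that those of each edge resolve the identity. -/
structure IsQuantumModel {V : Type v} (S : ContextualityScenario V)
    (H : Type u) [NormedAddCommGroup H] [InnerProductSpace ℂ H] [CompleteSpace H]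
    (P : V → H →L[ℂ] H) : Prop where
  selfAdjoint : ∀ x : V, IsSelfAdjoint (P x)
  idempotent : ∀ x : V, P x * P x = P x
  resolution : ∀ e ∈ S.edges, ∑ x ∈ e, P x = 1

/-- `S` allows a quantum model: it has one on some (finite- or infinite-dimensional) nonzero
complex Hilbert space. On the zero space the conditions would hold trivially, since `0 = 1`
there. -/
def AllowsQuantum {V : Type v} (S : ContextualityScenario V) : Prop :=
  ∃ (H : Type u) (_ : NormedAddCommGroup H) (_ : InnerProductSpace ℂ H) (_ : CompleteSpace H)
    (_ : Nontrivial H) (P : V → H →L[ℂ] H), S.IsQuantumModel H P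

end ContextualityScenario

/-- The code of a set `e` of vertices out of `0, …, n - 1`: its characteristic vector of length `n`
(symbols `some true`, `some false`), followed by the end marker `none`. -/
def edgeCode {n : ℕ} (e : Finset (Fin n)) : List (Option Bool) :=
  List.ofFn (fun i : Fin n => some (decide (i ∈ e))) ++ [none]

/-- The code of a list of edges: the rows of the edge-vertex incidence matrix, one after another. -/
def edgeListCode {n : ℕ} (l : List (Finset (Fin n))) : List (Option Bool) :=
  l.flatMap edgeCode

/-- The decision problem `k`-ALLOWS-QUANTUM, as the language of the codes of its yes-instances.
An instance is a contextuality scenario on the vertices `0, …, n - 1` with all edges of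
cardinality at most `k`. It is presented by any list of its edges, that is, by an incidence matrix
with the rows in any order. Since such a scenario has at most `k` times as many vertices as edges,
the length of this presentation is polynomially related to that of any other usual one. -/
def kAllowsQuantum (k : ℕ) : Language (Option Bool) :=
  {w | ∃ (n : ℕ) (S : ContextualityScenario (Fin n)) (l : List (Finset (Fin n))),
    (∀ e, e ∈ l ↔ e ∈ S.edges) ∧ w = edgeListCode l ∧
    (∀ e ∈ S.edges, e.card ≤ k) ∧ ContextualityScenario.AllowsQuantum.{u} S}

open Classical in
/-- A language is decidable in polynomial time: some Turing machine (in the multi-stack form of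
Mathlib), started on any word `w` over the alphabet, halts within `p (length of w)` steps for a
fixed polynomial `p`, with output `true` if `w` is in the language and `false` if it is not. -/
def DecidableInPolyTime {A : Type} (L : Language A) : Prop :=
  Nonempty (Turing.TM2ComputableInPolyTime (Computability.encodingList A).encode
    Computability.encodeBool (fun w : List A => decide (w ∈ L)))

/-! An edge {a, b} forces P_b = 1 - P_a, an edge {a} forces P_a = 1, and an empty edge is
impossible. A Boolean function c on projections with c(1) = true and c(1 - p) = !c(p)
(`exists_bool_of_idempotent`) thus turns a quantum model into an assignment with an odd number of
true vertices on each edge. Conversely, odd and at most 2 means exactly one, so such an assignment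
is a one-dimensional model (`allowsQuantum_iff`). What remains is a linear system over the field
with two elements, one equation per edge.

The system is solved by elimination. In each pass the first row with leading entry 1 becomes the
pivot: it is added to the later rows with leading entry 1 and to itself, which makes it zero, and
every row loses its leading column. This preserves solvability (`good_iff_pass`). Entries also carry
their original values, so the same passes check that the input is the incidence matrix of a scenario
(`Regular`, `mem_kAllowsQuantum_two_iff`). A pass takes linear time and shortens the word, so the
total time is quadratic (`outputs_lead`). -/

/-! ### Quantum models and parity -/

namespace ContextualityScenario

/-- On projections, an involution `p ↦ 1 - p` without fixed points admits a choice of one element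
in each orbit. -/
theorem exists_bool_of_idempotent {A : Type*} [Ring A] [Nontrivial A] :
    ∃ c : A → Bool, c 1 = true ∧ ∀ p, p * p = p → c (1 - p) = !c p := by
  classical
  let _ : LinearOrder A := linearOrderOfSTO (WellOrderingRel (α := A))
  -- If p = 1 - p, then p = p² = (1 - p)p = 0, hence 0 = 1.
  have hne (p : A) (hp : p * p = p) : p ≠ 1 - p := fun h => by
    have h0 : p * p = 0 := by
      nth_rw 1 [h]
      rw [sub_mul, one_mul, hp, sub_self]
    rw [← hp, h0] at h
    simp at h
  -- The order tells p from 1 - p; comparing with the answer at 1 normalises c(1) to `true`.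
  refine ⟨fun p => decide (p < 1 - p) == decide ((1 : A) < 1 - 1), by simp, fun p hp => ?_⟩
  have : (1 - p < p) ↔ ¬ p < 1 - p := by
    rw [not_lt]
    exact ⟨le_of_lt, fun h => lt_of_le_of_ne h (hne p hp).symm⟩
  simp only [sub_sub_cancel, decide_eq_decide.2 this]
  by_cases h1 : p < 1 - p <;> simp [h1]

theorem allowsQuantum_iff {V : Type v} (S : ContextualityScenario V)
    (hS : ∀ e ∈ S.edges, e.card ≤ 2) :
    AllowsQuantum.{u} S ↔
      ∃ f : V → Bool, ∀ e ∈ S.edges, Odd (e.filter fun x => f x = true).card := by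
  classical
  constructor
  · rintro ⟨H, _, _, _, _, P, hP⟩
    obtain ⟨c, hc1, hc⟩ := exists_bool_of_idempotent (A := H →L[ℂ] H)
    refine ⟨fun x => c (P x), fun e he => ?_⟩
    have hres := hP.resolution e he
    obtain h | h | h : e.card = 0 ∨ e.card = 1 ∨ e.card = 2 := by have := hS e he; omega
    · rw [Finset.card_eq_zero.1 h, Finset.sum_empty] at hres
      exact absurd hres zero_ne_one
    · obtain ⟨a, rfl⟩ := Finset.card_eq_one.1 h
      rw [Finset.sum_singleton] at hres
      simp [Finset.filter_singleton, hres, hc1]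
    · obtain ⟨a, b, hab, rfl⟩ := Finset.card_eq_two.1 h
      rw [Finset.sum_pair hab] at hres
      have hb : c (P b) = !c (P a) := by
        rw [← hc _ (hP.idempotent a), ← hres, add_sub_cancel_left]
      simp only [Finset.filter_insert, Finset.filter_singleton, hb]
      by_cases ha : c (P a) = true <;> simp [ha]
  · rintro ⟨f, hf⟩
    -- A copy of ℂ in universe `u`.
    refine ⟨EuclideanSpace ℂ PUnit.{u + 1}, inferInstance, inferInstance, inferInstance,
      inferInstance, fun x => if f x = true then 1 else 0, ⟨fun x => ?_, fun x => ?_,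
      fun e he => ?_⟩⟩
    · split_ifs
      · exact .one _
      · exact .zero _
    · split_ifs <;> simp
    · have h1 : (e.filter fun x => f x = true).card = 1 := by
        obtain ⟨k, hk⟩ := hf e he
        have := (Finset.card_filter_le e fun x => f x = true).trans (hS e he)
        omega
      rw [← Finset.sum_filter, Finset.sum_const, h1, one_smul]

end ContextualityScenario

/-! ### The machine

A multi-stack machine that solves a system of linear equations over the field with two elements by
eliminating one column after the other. -/

namespace ParityElimination

open Turing StateTransition

/-- A symbol of the augmented matrix: an entry, paired with the original entry at its place, or the
right-hand side of an equation, which ends its row. -/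
abbrev Sym : Type := (Bool × Bool) ⊕ Bool

/-- The stacks of the machine. -/
inductive Stack
  | inp | work | out | piv | tmp | res
  deriving DecidableEq

instance : Fintype Stack :=
  ⟨{.inp, .work, .out, .piv, .tmp, .res}, fun x => by cases x <;> decide⟩

/-- The alphabets of the stacks. -/
@[reducible] def Alphabet : Stack → Type
  | .inp => Option Bool
  | .res => Bool
  | _ => Sym

/-- How much of the current row was read: nothing, or a part with zero, one or two entries `true`;
`dead` means that some row had too many. -/
inductive ScanState
  | fresh | zero | one | two | dead
  deriving DecidableEq

instance : Fintype ScanState :=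
  ⟨{.fresh, .zero, .one, .two, .dead}, fun x => by cases x <;> decide⟩

/-- The transitions between the states of the scan. -/
def ScanState.next : ScanState → Option Bool → ScanState
  | .dead, _ => .dead
  | _, none => .fresh
  | .fresh, some false => .zero
  | .fresh, some true => .one
  | s, some false => s
  | .zero, some true => .one
  | .one, some true => .two
  | .two, some true => .dead

/-- What was seen in one pass through the rows: a nonempty row, an empty row, an empty row with
right-hand side `true`, an original entry `true` in the leading column. -/
structure Flags where
  entry : Bool
  ended : Bool
  bad : Bool
  cover : Bool
  deriving DecidableEq, Fintype

/-- The labels of the machine. -/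
inductive Label
  | scan (s : ScanState)
  | back
  | lead (F : Flags)
  | copy (F : Flags)
  | xor (F : Flags)
  | restore (F : Flags)
  | clear
  | clean (b : Bool)
  deriving DecidableEq, Fintype

/-- Where to go at the end of the scan. -/
def ScanState.exit : ScanState → Label
  | .fresh => .back
  -- An unterminated row, or a row with more than two entries `true`.
  | _ => .clean false

/-- The symbol under which the machine stores an input symbol. -/
def inputSym : Option Bool → Sym
  | some b => .inl (b, b)
  -- Right-hand side 1: every edge demands odd parity.
  | none => .inr true

/-- The sum of two symbols; the shape and the original entry are those of the first. -/
def addSym : Sym → Sym → Sym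
  | .inl (o, c), .inl (_, c') => .inl (o, c ^^ c')
  | .inr b, .inr b' => .inr (b ^^ b')
  | x, _ => x

/-- The flags of an empty pass. -/
def Flags.init : Flags := ⟨false, false, false, false⟩

/-- Record the leading entry of a row. -/
def Flags.addEntry (F : Flags) (o : Bool) : Flags := { F with entry := true, cover := F.cover || o }

/-- Record an empty row. -/
def Flags.addEnd (F : Flags) (b : Bool) : Flags := { F with ended := true, bad := F.bad || b }

/-- Where to go at the end of a pass. -/
def Flags.exit (F : Flags) : Label :=
  -- Rows of unequal length or an uncovered column mean rejection; once all rows are empty, the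
  -- equations 0 = b decide.
  if F.entry then (if !F.ended && F.cover then .clear else .clean false) else .clean (!F.bad)

/-- The registers of the machine hold two symbols. -/
abbrev Register : Type := Option Sym × Option Sym

/-- The label after the leading symbol of a row was read. -/
def Flags.afterLead (F : Flags) : Option Sym → Label
  | none => F.exit
  | some (.inr b) => .lead (F.addEnd b)
  | some (.inl (o, false)) => .copy (F.addEntry o)
  | some (.inl (o, true)) => .xor (F.addEntry o)

/-- The program of the machine. -/
def program : Label → TM2.Stmt Alphabet Label Register
  | .scan s =>
    .pop .inp (fun _ a => (a.map inputSym, none)) <|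
    .branch (fun v => v.1.isSome)
      (.push .out (fun v => v.1.getD default) <|
        .goto fun v => .scan (s.next (match v.1 with
          | some (.inl (b, _)) => some b
          | _ => none)))
      (.goto fun _ => s.exit)
  | .back =>
    .pop .out (fun _ a => (a, none)) <|
    .branch (fun v => v.1.isSome)
      (.push .work (fun v => v.1.getD default) <| .goto fun _ => .back)
      (.goto fun _ => .lead .init)
  | .lead F =>
    .pop .work (fun _ a => (a, none)) <| .goto fun v => F.afterLead v.1
  | .copy F =>
    .pop .work (fun _ a => (a, none)) <|
    .push .out (fun v => v.1.getD default) <|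
    .goto fun v => match v.1 with
      | some (.inl _) => .copy F
      | _ => .lead F
  | .xor F =>
    .pop .work (fun _ a => (a, none)) <|
    -- On an empty pivot stack the symbol is added to itself: the row becomes zero and its old
    -- value, saved on `tmp`, becomes the pivot.
    .pop .piv (fun v a => (v.1, a <|> v.1)) <|
    .push .out (fun v => addSym (v.1.getD default) (v.2.getD default)) <|
    .push .tmp (fun v => v.2.getD default) <|
    .goto fun v => match v.1 with
      | some (.inl _) => .xor F
      | _ => .restore F
  | .restore F =>
    .pop .tmp (fun _ a => (a, none)) <|
    .branch (fun v => v.1.isSome)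
      (.push .piv (fun v => v.1.getD default) <| .goto fun _ => .restore F)
      (.goto fun _ => .lead F)
  | .clear =>
    .pop .piv (fun _ a => (a, none)) <|
    .goto fun v => if v.1.isSome then .clear else .back
  | .clean b =>
    .pop .out (fun _ a => (a, none)) <|
    .pop .piv (fun v a => (v.1, a)) <|
    .branch (fun v => v.1.isSome || v.2.isSome)
      (.goto fun _ => .clean b)
      (.push .res (fun _ => b) <| .load (fun _ => (none, none)) .halt)

/-- The machine. -/
def machine : FinTM2 where
  K := Stack
  k₀ := .inp
  k₁ := .res
  Γ := Alphabet
  Λ := Label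
  main := .scan .fresh
  σ := Register
  initialState := (none, none)
  Γk₀Fin := inferInstanceAs (Fintype (Option Bool))
  m := program

/-- The contents of the stacks, from top to bottom. -/
def stk (i : List (Option Bool)) (w o p t : List Sym) (r : List Bool) :
    ∀ k, List (Alphabet k)
  | .inp => i
  | .work => w
  | .out => o
  | .piv => p
  | .tmp => t
  | .res => r

section update
variable (i i' : List (Option Bool)) (w o p t x : List Sym) (r r' : List Bool)

@[simp] theorem update_inp :
    Function.update (stk i w o p t r) .inp i' = stk i' w o p t r := by
  funext k; cases k <;> rfl
@[simp] theorem update_work :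
    Function.update (stk i w o p t r) .work x = stk i x o p t r := by
  funext k; cases k <;> rfl
@[simp] theorem update_out :
    Function.update (stk i w o p t r) .out x = stk i w x p t r := by
  funext k; cases k <;> rfl
@[simp] theorem update_piv :
    Function.update (stk i w o p t r) .piv x = stk i w o x t r := by
  funext k; cases k <;> rfl
@[simp] theorem update_tmp :
    Function.update (stk i w o p t r) .tmp x = stk i w o p x r := by
  funext k; cases k <;> rfl
@[simp] theorem update_res :
    Function.update (stk i w o p t r) .res r' = stk i w o p t r' := by
  funext k; cases k <;> rfl
@[simp] theorem stk_inp : stk i w o p t r .inp = i := rfl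
@[simp] theorem stk_work : stk i w o p t r .work = w := rfl
@[simp] theorem stk_out : stk i w o p t r .out = o := rfl
@[simp] theorem stk_piv : stk i w o p t r .piv = p := rfl
@[simp] theorem stk_tmp : stk i w o p t r .tmp = t := rfl
@[simp] theorem stk_res : stk i w o p t r .res = r := rfl

end update

/-! ### Timed runs and their composition -/

/-- From label `l` and stacks `S` the machine gets to `l'` and `S'` in at most `n` steps, whatever
its registers hold. -/
def Leads (n : ℕ) (l : Label) (S : ∀ k, List (Alphabet k)) (l' : Label)
    (S' : ∀ k, List (Alphabet k)) : Prop :=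
  ∀ v, ∃ v', Nonempty (EvalsToInTime (TM2.step program) ⟨some l, v, S⟩ (some ⟨some l', v', S'⟩) n)

/-- From label `l` and stacks `S` the machine halts within `n` steps with output `b` and all other
stacks empty. -/
def Outputs (n : ℕ) (l : Label) (S : ∀ k, List (Alphabet k)) (b : Bool) : Prop :=
  ∀ v, Nonempty (EvalsToInTime (TM2.step program) ⟨some l, v, S⟩
    (some ⟨none, (none, none), stk [] [] [] [] [] [b]⟩) n)

theorem evalsToInTime_mono {α : Type*} {f : α → Option α} {a : α} {b : Option α} {m n : ℕ}
    (h : m ≤ n) (e : EvalsToInTime f a b m) : Nonempty (EvalsToInTime f a b n) :=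
  ⟨⟨e.toEvalsTo, e.steps_le_m.trans h⟩⟩

theorem evalsToInTime_one {α : Type*} {f : α → Option α} {a : α} {b : Option α} (h : f a = b) :
    Nonempty (EvalsToInTime f a b 1) :=
  ⟨⟨⟨1, h⟩, le_rfl⟩⟩

section
variable {m n k : ℕ} {l l' l'' : Label} {S S' S'' : ∀ k, List (Alphabet k)} {b : Bool}

theorem Leads.refl : Leads n l S l S := fun v =>
  ⟨v, evalsToInTime_mono (Nat.zero_le n) (.refl _ _)⟩

theorem Leads.trans (h : Leads m l S l' S') (h' : Leads n l' S' l'' S'') (hk : m + n ≤ k) :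
    Leads k l S l'' S'' := fun v => by
  obtain ⟨v', ⟨e⟩⟩ := h v
  obtain ⟨v'', ⟨e'⟩⟩ := h' v'
  exact ⟨v'', evalsToInTime_mono (by omega) (.trans _ _ _ _ _ _ e e')⟩

theorem Leads.outputs (h : Leads m l S l' S') (h' : Outputs n l' S' b) (hk : m + n ≤ k) :
    Outputs k l S b := fun v => by
  obtain ⟨v', ⟨e⟩⟩ := h v
  obtain ⟨e'⟩ := h' v'
  exact evalsToInTime_mono (by omega) (.trans _ _ _ _ _ _ e e')

theorem Leads.mono (h : Leads m l S l' S') (hk : m ≤ k) : Leads k l S l' S' :=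
  h.trans .refl (n := 0) (by simpa using hk)

theorem Leads.of_step
    (h : ∀ v, ∃ v', TM2.step program ⟨some l, v, S⟩ = some ⟨some l', v', S'⟩) :
    Leads 1 l S l' S' := fun v =>
  (h v).imp fun _ hv => evalsToInTime_one hv

end

/-! ### The loops of the machine -/

theorem leads_scan (i : List (Option Bool)) (o : List Sym) (s : ScanState) :
    Leads (i.length + 1) (.scan s) (stk i [] o [] [] [])
      (i.foldl ScanState.next s).exit
      (stk [] [] ((i.map inputSym).reverse ++ o) [] [] []) := by
  induction i generalizing o s with
  | nil => exact .of_step fun v => by simp [program]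
  | cons a i ih =>
    have h : Leads 1 (.scan s) (stk (a :: i) [] o [] [] []) (.scan (s.next a))
        (stk i [] (inputSym a :: o) [] [] []) :=
      .of_step fun v => by rcases a with _ | a <;> simp [program, inputSym]
    simpa using h.trans (ih _ _) (by omega)

theorem leads_back (w o p t : List Sym) :
    Leads (o.length + 1) .back (stk [] w o p t [])
      (.lead .init) (stk [] (o.reverse ++ w) [] p t []) := by
  induction o generalizing w with
  | nil => exact .of_step fun v => by simp [program]
  | cons x o ih =>
    have h : Leads 1 .back (stk [] w (x :: o) p t []) .back (stk [] (x :: w) o p t []) :=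
      .of_step fun v => by simp [program]
    simpa using h.trans (ih _) (by omega)

theorem leads_restore (F : Flags) (w o p t : List Sym) :
    Leads (t.length + 1) (.restore F) (stk [] w o p t [])
      (.lead F) (stk [] w o (t.reverse ++ p) [] []) := by
  induction t generalizing p with
  | nil => exact .of_step fun v => by simp [program]
  | cons x t ih =>
    have h : Leads 1 (.restore F) (stk [] w o p (x :: t) [])
        (.restore F) (stk [] w o (x :: p) t []) :=
      .of_step fun v => by simp [program]
    simpa using h.trans (ih _) (by omega)

theorem leads_clear (w o p : List Sym) :
    Leads (p.length + 1) .clear (stk [] w o p [] []) .back (stk [] w o [] [] []) := by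
  induction p with
  | nil => exact .of_step fun v => by simp [program]
  | cons x p ih =>
    exact Leads.trans (m := 1) (.of_step fun v => by simp [program]) ih (by simp; omega)

theorem outputs_clean (b : Bool) (o p : List Sym) :
    Outputs (o.length + p.length + 1) (.clean b) (stk [] [] o p [] []) b := by
  induction h : o.length + p.length using Nat.strong_induction_on generalizing o p with
  | _ n ih =>
    rcases n with _ | n
    · obtain ⟨rfl, rfl⟩ : o = [] ∧ p = [] := by
        constructor <;> apply List.eq_nil_of_length_eq_zero <;> omega
      exact fun v => evalsToInTime_one (by simp [program])
    · have h' : o.tail.length + p.tail.length < n + 1 := by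
        simp only [List.length_tail]; omega
      refine Leads.outputs (m := 1) (.of_step fun v => ?_) (ih _ h' o.tail p.tail rfl) (by omega)
      rcases o with _ | ⟨x, o⟩ <;> rcases p with _ | ⟨y, p⟩ <;> simp_all [program]

/-! ### Rows and passes -/

/-- A row of the augmented matrix. An entry consists of the original and the current entry. -/
inductive Row
  | rhs (b : Bool)
  | cons (o c : Bool) (r : Row)

namespace Row

/-- The word that represents a row on a stack. -/
def enc : Row → List Sym
  | rhs b => [.inr b]
  | cons o c r => .inl (o, c) :: r.enc

/-- The original entries of a row. -/
def orig : Row → List Bool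
  | rhs _ => []
  | cons o _ r => o :: r.orig

/-- The sum of the two sides of the equation that a row stands for, at the assignment `x`. -/
def eval : Row → (ℕ → Bool) → Bool
  | rhs b, _ => b
  | cons _ c r, x => (c && x 0) ^^ r.eval fun i => x (i + 1)

/-- The word that the machine adds to a row if the word on the pivot stack is `p`. -/
def summand : Row → List Sym → List Sym
  | rhs b, p => [p.head?.getD (.inr b)]
  | cons o c r, p => p.head?.getD (.inl (o, c)) :: r.summand p.tail

/-- The row that results from adding the pivot word `p`. -/
def add : Row → List Sym → Row
  | rhs b, .inr b' :: _ => rhs (b ^^ b')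
  | rhs _, [] => rhs false
  -- Shapes clash only for rows of unequal length, which are met before they can be rejected; the
  -- value follows `addSym`.
  | rhs b, .inl _ :: _ => rhs b
  | cons o c r, .inl (_, c') :: p => cons o (c ^^ c') (r.add p)
  | cons o _ r, [] => cons o false (r.add [])
  | cons o c r, .inr _ :: p => cons o c (r.add p)

theorem length_enc (r : Row) : r.enc.length = r.orig.length + 1 := by
  induction r <;> simp_all [enc, orig]

theorem length_summand (r : Row) (p : List Sym) : (r.summand p).length = r.enc.length := by
  induction r generalizing p <;> simp_all [enc, summand]

@[simp] theorem orig_add (r : Row) (p : List Sym) : (r.add p).orig = r.orig := by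
  induction r generalizing p with
  | rhs b => rcases p with _ | ⟨_ | _, p⟩ <;> rfl
  | cons o c r ih => rcases p with _ | ⟨_ | _, p⟩ <;> simp [add, orig, ih]

@[simp] theorem summand_nil (r : Row) : r.summand [] = r.enc := by
  induction r <;> simp_all [enc, summand]

theorem summand_enc (r q : Row) (h : r.orig.length = q.orig.length) :
    r.summand q.enc = q.enc := by
  induction r generalizing q with
  | rhs b => cases q <;> simp_all [enc, summand, orig]
  | cons o c r ih => cases q <;> simp_all [enc, summand, orig]

theorem eval_add_nil (r : Row) (x : ℕ → Bool) : (r.add []).eval x = false := by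
  induction r generalizing x <;> simp_all [add, eval]

theorem eval_add_enc (r q : Row) (h : r.orig.length = q.orig.length) (x : ℕ → Bool) :
    (r.add q.enc).eval x = (r.eval x ^^ q.eval x) := by
  induction r generalizing q x with
  | rhs b => cases q <;> simp_all [enc, add, eval, orig]
  | cons o c r ih =>
    cases q with
    | rhs b => simp [orig] at h
    | cons o' c' q =>
      simp only [enc, add, eval, ih q (by simpa [orig] using h)]
      cases c <;> cases c' <;> cases x 0 <;> simp

/-- The pivot word after adding it to a row. -/
def nextPivot (r : Row) (p : List Sym) : List Sym := r.summand p ++ p.drop r.enc.length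

@[simp] theorem nextPivot_nil (r : Row) : r.nextPivot [] = r.enc := by simp [nextPivot]

/-- Among rows of equal length the pivot, once chosen, stays fixed for the whole pass. -/
theorem nextPivot_enc (r q : Row) (h : r.orig.length = q.orig.length) :
    r.nextPivot q.enc = q.enc := by
  rw [nextPivot, r.summand_enc q h, List.drop_eq_nil_of_le, List.append_nil]
  rw [length_enc, length_enc, h]

end Row

/-! ### Elimination of one column -/

/-- The word that represents a list of rows. -/
def encs (R : List Row) : List Sym := R.flatMap Row.enc

@[simp] theorem encs_cons (r : Row) (R : List Row) : encs (r :: R) = r.enc ++ encs R := rfl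

/-- Elimination of the leading column, with pivot word `p`. -/
def pass : List Sym → List Row → List Row
  | _, [] => []
  | p, .rhs _ :: R => pass p R
  | p, .cons _ false r :: R => r :: pass p R
  | p, .cons _ true r :: R => r.add p :: pass (r.nextPivot p) R

/-- Every row gives up its leading symbol. This decrease drives the induction in `outputs_lead`. -/
theorem length_encs_pass (p : List Sym) (R : List Row) :
    (encs (pass p R)).length + R.length ≤ (encs R).length := by
  induction R generalizing p with
  | nil => simp [pass]
  | cons r R ih =>
    rcases r with b | ⟨o, _ | _, r⟩
    · have := ih p; simp [pass, Row.enc]; omega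
    · have := ih p; simp [pass, Row.enc]; omega
    · have := ih (r.nextPivot p); simp [pass, Row.enc, Row.length_enc]; omega

/-- Record the leading symbol of a row. -/
def Flags.addRow (F : Flags) : Row → Flags
  | .rhs b => F.addEnd b
  | .cons o _ _ => F.addEntry o

theorem leads_copy (F : Flags) (r : Row) (w o p : List Sym) :
    Leads r.enc.length (.copy F) (stk [] (r.enc ++ w) o p [] [])
      (.lead F) (stk [] w (r.enc.reverse ++ o) p [] []) := by
  induction r generalizing o with
  | rhs b => exact .of_step fun v => by simp [program, Row.enc]
  | cons a c r ih =>
    have h : Leads 1 (.copy F) (stk [] ((Row.cons a c r).enc ++ w) o p [] [])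
        (.copy F) (stk [] (r.enc ++ w) (.inl (a, c) :: o) p [] []) :=
      .of_step fun v => by simp [program, Row.enc]
    simpa [Row.enc] using h.trans (ih _) (Nat.add_comm _ _).le

theorem leads_xor (F : Flags) (r : Row) (w o p t : List Sym) :
    Leads r.enc.length (.xor F) (stk [] (r.enc ++ w) o p t [])
      (.restore F) (stk [] w ((r.add p).enc.reverse ++ o) (p.drop r.enc.length)
        ((r.summand p).reverse ++ t) []) := by
  induction r generalizing o p t with
  | rhs b =>
    exact .of_step fun v => by
      rcases p with _ | ⟨_ | _, p⟩ <;> simp [program, Row.enc, Row.add, Row.summand, addSym]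
  | cons a c r ih =>
    have h : Leads 1 (.xor F) (stk [] ((Row.cons a c r).enc ++ w) o p t [])
        (.xor F) (stk [] (r.enc ++ w) (addSym (.inl (a, c)) (p.head?.getD (.inl (a, c))) :: o)
          p.tail (p.head?.getD (.inl (a, c)) :: t) []) :=
      .of_step fun v => by rcases p with _ | ⟨y, p⟩ <;> simp [program, Row.enc]
    have h' := h.trans (ih _ _ _) (Nat.add_comm _ _).le
    rcases p with _ | ⟨_ | _, p⟩ <;>
      simpa [Row.enc, Row.add, Row.summand, addSym] using h'

/-- The factor 2 comes from rows that are added to: `xor` and `restore` both traverse the row. The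
bound on `p'` pays for emptying the pivot stack later. -/
theorem leads_pass (F : Flags) (R : List Row) (o p : List Sym) :
    ∃ p' : List Sym, p'.length ≤ p.length + (encs R).length ∧
      Leads (2 * (encs R).length) (.lead F) (stk [] (encs R) o p [] [])
        (.lead (R.foldl Flags.addRow F))
        (stk [] [] ((encs (pass p R)).reverse ++ o) p' [] []) := by
  induction R generalizing F o p with
  | nil => exact ⟨p, by simp, .refl⟩
  | cons r R ih =>
    have h {l : Label} {w : List Sym} (hl : F.afterLead (r.enc ++ encs R).head? = l)
        (hw : (r.enc ++ encs R).tail = w) :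
        Leads 1 (.lead F) (stk [] (encs (r :: R)) o p [] []) l (stk [] w o p [] []) :=
      .of_step fun v => by subst hl hw; simp [program]
    rcases r with b | ⟨a, _ | _, r⟩
    · obtain ⟨p', hp, h'⟩ := ih (F.addEnd b) o p
      refine ⟨p', by simp; omega, (h rfl rfl).trans h' ?_⟩
      simp [Row.enc]; omega
    · obtain ⟨p', hp, h'⟩ := ih (F.addEntry a) (r.enc.reverse ++ o) p
      refine ⟨p', by simp; omega, ?_⟩
      have h'' := ((h rfl rfl).trans (leads_copy _ _ _ _ _) le_rfl).trans h' le_rfl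
      simp only [pass, encs_cons, List.reverse_append, List.append_assoc]
      refine h''.mono ?_
      simp [Row.enc]; omega
    · obtain ⟨p', hp, h'⟩ := ih (F.addEntry a) ((r.add p).enc.reverse ++ o) (r.nextPivot p)
      have hl : (r.nextPivot p).length ≤ p.length + r.enc.length := by
        simp [Row.nextPivot, Row.length_summand]; omega
      refine ⟨p', by simp [Row.enc]; omega, ?_⟩
      have h'' := ((h rfl rfl).trans (leads_xor _ _ _ _ _ _) le_rfl).trans
        (leads_restore _ _ _ _ _) le_rfl
      simp only [List.append_nil, List.reverse_reverse] at h''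
      have h''' := h''.trans h' le_rfl
      simp only [pass, encs_cons, List.reverse_append, List.append_assoc]
      refine h'''.mono ?_
      simp [Row.enc, Row.length_summand]; omega

/-! ### Correctness of the elimination -/

/-- All rows have the same length and every column has an entry `true`. -/
structure Regular (M : List (List Bool)) : Prop where
  length_eq : ∀ l ∈ M, ∀ l' ∈ M, l.length = l'.length
  cover : ∀ l ∈ M, ∀ i < l.length, ∃ l' ∈ M, l'[i]? = some true

theorem regular_iff_tail {M : List (List Bool)} (hM : M ≠ []) (hne : ∀ l ∈ M, l ≠ []) :
    Regular M ↔ (∃ l ∈ M, l.head? = some true) ∧ Regular (M.map List.tail) := by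
  have hpos : ∀ l ∈ M, 0 < l.length := fun l hl => List.length_pos_iff.2 (hne l hl)
  constructor
  · intro h
    refine ⟨?_, ⟨?_, ?_⟩⟩
    · obtain ⟨l, hl⟩ := List.exists_mem_of_ne_nil M hM
      obtain ⟨l', hl', h0⟩ := h.cover l hl 0 (hpos l hl)
      exact ⟨l', hl', by rw [List.head?_eq_getElem?, h0]⟩
    · simp only [List.mem_map, forall_exists_index, and_imp]
      rintro _ l hl rfl _ l' hl' rfl
      simp [h.length_eq l hl l' hl']
    · simp only [List.mem_map, forall_exists_index, and_imp]
      rintro _ l hl rfl i hi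
      rw [List.length_tail] at hi
      obtain ⟨l', hl', h0⟩ := h.cover l hl (i + 1) (by omega)
      exact ⟨_, ⟨l', hl', rfl⟩, by simpa using h0⟩
  · rintro ⟨⟨l₀, hl₀, h0⟩, h⟩
    refine ⟨fun l hl l' hl' => ?_, fun l hl i hi => ?_⟩
    · have := h.length_eq _ (List.mem_map_of_mem hl) _ (List.mem_map_of_mem hl')
      have := hpos l hl
      have := hpos l' hl'
      simp only [List.length_tail] at *
      omega
    · rcases i with _ | i
      · exact ⟨l₀, hl₀, by rw [← List.head?_eq_getElem?, h0]⟩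
      · obtain ⟨_, hm, h1⟩ := h.cover _ (List.mem_map_of_mem hl) i (by
          rw [List.length_tail]; omega)
        obtain ⟨l', hl', rfl⟩ := List.mem_map.1 hm
        exact ⟨l', hl', by simpa using h1⟩

/-- The rows form a regular matrix and, as equations, have a common solution. -/
def Good (R : List Row) : Prop :=
  Regular (R.map Row.orig) ∧ ∃ x : ℕ → Bool, ∀ r ∈ R, r.eval x = false

theorem map_orig_pass (p : List Sym) (R : List Row) (hR : ∀ r ∈ R, r.orig ≠ []) :
    (pass p R).map Row.orig = (R.map Row.orig).map List.tail := by
  induction R generalizing p with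
  | nil => rfl
  | cons r R ih =>
    have hR' : ∀ r ∈ R, r.orig ≠ [] := fun r hr => hR r (by simp [hr])
    rcases r with b | ⟨o, _ | _, r⟩
    · simp [Row.orig] at hR
    · simpa [pass, Row.orig] using ih _ hR'
    · simpa [pass, Row.orig] using ih _ hR'

/-- The assignment `y`, shifted by one place, with the value `a` in front. -/
def consAssignment (a : Bool) (y : ℕ → Bool) : ℕ → Bool
  | 0 => a
  | i + 1 => y i

theorem eval_cons_consAssignment (o c a : Bool) (r : Row) (y : ℕ → Bool) :
    (Row.cons o c r).eval (consAssignment a y) = ((c && a) ^^ r.eval y) := rfl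

/-- The pivot equation x₀ + q(y) = 0 forces x₀ = q(y), and substituting this into a row with leading
entry 1 amounts to adding q. -/
theorem eval_pass_enc {n : ℕ} (q : Row) (hq : q.orig.length = n) (y : ℕ → Bool) (R : List Row)
    (hR : ∀ r ∈ R, r.orig.length = n + 1) :
    (∀ r ∈ pass q.enc R, r.eval y = false) ↔
      ∀ r ∈ R, r.eval (consAssignment (q.eval y) y) = false := by
  induction R with
  | nil => simp [pass]
  | cons r R ih =>
    have ih := ih fun r hr => hR r (by simp [hr])
    have hr := hR r (by simp)
    rcases r with b | ⟨o, _ | _, r⟩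
    · simp [Row.orig] at hr
    · simp [pass, ih, eval_cons_consAssignment]
    · have hr' : r.orig.length = q.orig.length := by simp [Row.orig] at hr; omega
      simp [pass, Row.nextPivot_enc r q hr', ih, eval_cons_consAssignment,
        Row.eval_add_enc r q hr', Bool.xor_comm (r.eval y)]

/-- Rows before the pivot do not involve x₀. The first row with leading entry 1 determines x₀ and
leaves the trivial equation; without such a row x₀ is free. -/
theorem eval_pass_nil {n : ℕ} (y : ℕ → Bool) (R : List Row)
    (hR : ∀ r ∈ R, r.orig.length = n + 1) :
    (∀ r ∈ pass [] R, r.eval y = false) ↔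
      ∃ a, ∀ r ∈ R, r.eval (consAssignment a y) = false := by
  induction R with
  | nil => simp [pass]
  | cons r R ih =>
    have hR' : ∀ r ∈ R, r.orig.length = n + 1 := fun r hr => hR r (by simp [hr])
    have hr := hR r (by simp)
    rcases r with b | ⟨o, _ | _, r⟩
    · simp [Row.orig] at hr
    · simp [pass, ih hR', eval_cons_consAssignment]
    · have hr' : r.orig.length = n := by simp [Row.orig] at hr; omega
      simp [pass, eval_pass_enc r hr' y R hR', eval_cons_consAssignment, Row.eval_add_nil]

theorem good_iff_pass {R : List Row} (hne : R ≠ []) (hR : ∀ r ∈ R, r.orig ≠ []) :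
    Good R ↔ (∃ r ∈ R, r.orig.head? = some true) ∧ Good (pass [] R) := by
  rw [Good, Good, map_orig_pass [] R hR, regular_iff_tail (by simpa) (by simpa)]
  simp only [List.mem_map, exists_exists_and_eq_and, and_assoc, and_congr_right_iff]
  intro _ hreg
  obtain ⟨r₀, hr₀⟩ := List.exists_mem_of_ne_nil R hne
  have hpos : ∀ r ∈ R, 0 < r.orig.length := fun r hr => List.length_pos_iff.2 (hR r hr)
  have hlen : ∀ r ∈ R, r.orig.length = (r₀.orig.length - 1) + 1 := by
    intro r hr
    have := hreg.length_eq r.orig.tail (by simpa using ⟨r, hr, rfl⟩) r₀.orig.tail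
      (by simpa using ⟨r₀, hr₀, rfl⟩)
    have := hpos r hr
    have := hpos r₀ hr₀
    simp only [List.length_tail] at *
    omega
  simp only [eval_pass_nil _ R hlen]
  constructor
  · rintro ⟨x, hx⟩
    refine ⟨fun i => x (i + 1), x 0, ?_⟩
    convert hx using 4 with r hr
    funext i
    cases i <;> rfl
  · rintro ⟨y, a, h⟩
    exact ⟨_, h⟩

theorem foldl_addRow (F : Flags) (R : List Row) :
    ((R.foldl Flags.addRow F).entry = true ↔ F.entry = true ∨ ∃ r ∈ R, r.orig ≠ []) ∧
    ((R.foldl Flags.addRow F).ended = true ↔ F.ended = true ∨ ∃ r ∈ R, r.orig = []) ∧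
    ((R.foldl Flags.addRow F).bad = true ↔ F.bad = true ∨ Row.rhs true ∈ R) ∧
    ((R.foldl Flags.addRow F).cover = true ↔
      F.cover = true ∨ ∃ r ∈ R, r.orig.head? = some true) := by
  induction R generalizing F with
  | nil => simp
  | cons r R ih =>
    obtain ⟨h1, h2, h3, h4⟩ := ih (F.addRow r)
    rw [List.foldl_cons, h1, h2, h3, h4]
    rcases r with (_ | _) | ⟨o, c, r⟩ <;>
      simp [Flags.addRow, Flags.addEnd, Flags.addEntry, Row.orig, or_assoc]

open Classical in
theorem outputs_lead (R : List Row) :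
    Outputs (4 * ((encs R).length + 1) ^ 2) (.lead .init) (stk [] (encs R) [] [] [] [])
      (decide (Good R)) := by
  induction hn : (encs R).length using Nat.strong_induction_on generalizing R with
  | _ n ih =>
    obtain ⟨p, hp, h⟩ := leads_pass .init R [] []
    have hlen := length_encs_pass [] R
    obtain ⟨hentry, hended, hbad, hcover⟩ := foldl_addRow .init R
    set F := R.foldl Flags.addRow .init
    simp only [List.append_nil, List.length_nil, Nat.zero_add] at h hp
    have h' : Leads (2 * n + 1) (.lead .init) (stk [] (encs R) [] [] [] []) F.exit
        (stk [] [] (encs (pass [] R)).reverse p [] []) :=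
      h.trans (n := 1) (.of_step fun v => by simp [program, Flags.afterLead]) (by omega)
    have hclean {b : Bool} (hb : F.exit = .clean b) (hG : Good R ↔ b = true) :
        Outputs (4 * (n + 1) ^ 2) (.lead .init) (stk [] (encs R) [] [] [] [])
          (decide (Good R)) := by
      have : decide (Good R) = b := by cases b <;> simpa using hG
      rw [this]
      rw [hb] at h'
      refine h'.outputs (outputs_clean _ _ _) ?_
      rw [List.length_reverse]
      nlinarith
    simp only [Flags.init, Bool.false_eq_true, false_or] at hentry hended hbad hcover
    by_cases he : F.entry = true
    · obtain ⟨r₀, hr₀, hr₀'⟩ := hentry.1 he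
      have hne : R ≠ [] := List.ne_nil_of_mem hr₀
      by_cases hs : F.ended = true
      · obtain ⟨r₁, hr₁, hr₁'⟩ := hended.1 hs
        refine hclean (b := false) (by simp [Flags.exit, he, hs]) ?_
        simp only [Bool.false_eq_true, iff_false]
        intro hG
        have := hG.1.length_eq _ (List.mem_map_of_mem hr₀) _ (List.mem_map_of_mem hr₁)
        simp [hr₁', hr₀'] at this
      · have hR : ∀ r ∈ R, r.orig ≠ [] := fun r hr hr' => hs (hended.2 ⟨r, hr, hr'⟩)
        have hG := good_iff_pass hne hR
        by_cases hc : F.cover = true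
        · rw [← hcover] at hG
          have hexit : F.exit = .clear := by simp [Flags.exit, he, hs, hc]
          rw [hexit] at h'
          have hpos := List.length_pos_iff.2 hne
          have hback := leads_back [] (encs (pass [] R)).reverse [] []
          rw [List.reverse_reverse, List.append_nil, List.length_reverse] at hback
          -- The pass costs 2n + 1, emptying the pivot stack at most n + 1, moving back at most n,
          -- and the recursion at most 4n².
          have := ((h'.trans (leads_clear _ _ _) le_rfl).trans hback le_rfl).outputs
            (ih _ (by omega) (pass [] R) rfl) (k := 4 * (n + 1) ^ 2) (by
              have : (encs (pass [] R)).length + 1 ≤ n := by omega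
              have := Nat.pow_le_pow_left this 2
              nlinarith)
          simpa [hG, hc] using this
        · refine hclean (b := false) (by simp [Flags.exit, he, hc]) ?_
          rw [hG, ← hcover]
          simp [hc]
    · have hR : ∀ r ∈ R, r.orig = [] := fun r hr => by
        by_contra hr'
        exact he (hentry.2 ⟨r, hr, hr'⟩)
      refine hclean (b := !F.bad) (by simp [Flags.exit, he]) ?_
      rw [Bool.not_eq_true', ← Bool.not_eq_true, hbad]
      constructor
      · rintro ⟨-, x, hx⟩ hm
        simpa [Row.eval] using hx _ hm
      · refine fun hm => ⟨⟨?_, ?_⟩, fun _ => false, fun r hr => ?_⟩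
        · simp +contextual [hR]
        · simp +contextual [hR]
        · rcases r with (_ | _) | ⟨o, c, r⟩
          · rfl
          · exact absurd hr hm
          · simpa [Row.orig] using hR _ hr

/-! ### The input -/

/-- The code of one row of a matrix. -/
def rowCode (l : List Bool) : List (Option Bool) := l.map some ++ [none]

/-- The equation that says that an odd number of the variables marked in `l` are true. -/
def rowOf : List Bool → Row
  | [] => .rhs true
  | b :: l => .cons b b (rowOf l)

@[simp] theorem orig_rowOf (l : List Bool) : (rowOf l).orig = l := by
  induction l <;> simp_all [rowOf, Row.orig]

theorem map_inputSym_rowCode (l : List Bool) : (rowCode l).map inputSym = (rowOf l).enc := by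
  induction l <;> simp_all [rowCode, rowOf, Row.enc, inputSym]

theorem map_inputSym_flatMap (M : List (List Bool)) :
    (M.flatMap rowCode).map inputSym = encs (M.map rowOf) := by
  simp [encs, List.map_flatMap, List.flatMap_map, map_inputSym_rowCode]

/-- The state of the scan within a row with `k` entries `true` so far. -/
def ScanState.ofCount : ℕ → ScanState
  | 0 => .zero
  | 1 => .one
  | 2 => .two
  | _ => .dead

theorem foldl_next_ofCount (k : ℕ) (l : List Bool) :
    (l.map some).foldl ScanState.next (.ofCount k) = .ofCount (k + l.count true) := by
  induction l generalizing k with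
  | nil => rfl
  | cons b l ih =>
    have h : (ScanState.ofCount k).next (some b) = .ofCount (k + b.toNat) := by
      rcases k with _ | _ | _ | k <;> cases b <;> rfl
    rw [List.map_cons, List.foldl_cons, h, ih]
    congr 1
    cases b
    · simp
    · simp
      omega

/-- On entries, `fresh` acts like `zero`; they differ only so that a word ending inside a row is
rejected. -/
theorem foldl_next_fresh {l : List Bool} (hl : l ≠ []) :
    (l.map some).foldl ScanState.next .fresh = .ofCount (l.count true) := by
  have := foldl_next_ofCount 0 l
  rw [Nat.zero_add] at this
  rw [← this]
  rcases l with _ | ⟨_ | _, l⟩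
  · exact absurd rfl hl
  · rfl
  · rfl

theorem foldl_next_dead (w : List (Option Bool)) : w.foldl ScanState.next .dead = .dead := by
  induction w with
  | nil => rfl
  | cons a w ih => rcases a with _ | _ | _ <;> exact ih

theorem foldl_next_rowCode (l : List Bool) :
    (rowCode l).foldl ScanState.next .fresh = if l.count true ≤ 2 then .fresh else .dead := by
  rw [rowCode, List.foldl_append]
  rcases eq_or_ne l [] with rfl | hl
  · rfl
  · rw [foldl_next_fresh hl]
    generalize l.count true = k
    rcases k with _ | _ | _ | k
    · rfl
    · rfl
    · rfl
    · rw [if_neg (by omega)]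
      rfl

theorem exists_rowCode_prefix (w : List (Option Bool)) :
    ∃ l : List Bool, w = l.map some ∨ ∃ w', w = rowCode l ++ w' := by
  induction w with
  | nil => exact ⟨[], .inl rfl⟩
  | cons a w ih =>
    obtain ⟨l, h⟩ := ih
    rcases a with _ | b
    · exact ⟨[], .inr ⟨w, rfl⟩⟩
    · refine ⟨b :: l, h.imp (by rintro rfl; rfl) ?_⟩
      rintro ⟨w', rfl⟩
      exact ⟨w', rfl⟩

theorem foldl_next_eq_fresh_iff (w : List (Option Bool)) :
    w.foldl ScanState.next .fresh = .fresh ↔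
      ∃ M : List (List Bool), w = M.flatMap rowCode ∧ ∀ l ∈ M, l.count true ≤ 2 := by
  constructor
  · induction hn : w.length using Nat.strong_induction_on generalizing w with
    | _ n ih =>
      intro h
      obtain ⟨l, rfl | ⟨w', rfl⟩⟩ := exists_rowCode_prefix w
      · rcases eq_or_ne l [] with rfl | hl
        · exact ⟨[], rfl, by simp⟩
        · rw [foldl_next_fresh hl] at h
          generalize l.count true = k at h
          rcases k with _ | _ | _ | k <;> cases h
      · rw [List.foldl_append, foldl_next_rowCode] at h
        split_ifs at h with hl
        · obtain ⟨M, rfl, hM⟩ := ih w'.length (by simp [← hn, rowCode]; omega) w' rfl h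
          exact ⟨l :: M, rfl, by simpa [hl] using hM⟩
        · rw [foldl_next_dead] at h
          cases h
  · rintro ⟨M, rfl, hM⟩
    induction M with
    | nil => rfl
    | cons l M ih =>
      rw [List.flatMap_cons, List.foldl_append, foldl_next_rowCode, if_pos (hM l (by simp))]
      exact ih fun l hl => hM l (by simp [hl])

theorem rowCode_append_inj {l l' : List Bool} {w w' : List (Option Bool)}
    (h : rowCode l ++ w = rowCode l' ++ w') : l = l' ∧ w = w' := by
  induction l generalizing l' with
  | nil => rcases l' with _ | ⟨b, l'⟩ <;> simp_all [rowCode]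
  | cons b l ih =>
    rcases l' with _ | ⟨b', l'⟩
    · simp [rowCode] at h
    · simp only [rowCode, List.map_cons, List.cons_append, List.cons.injEq, Option.some.injEq] at h
      obtain ⟨rfl, h⟩ := h
      obtain ⟨rfl, rfl⟩ := ih h
      exact ⟨rfl, rfl⟩

/-- End markers make the row codes a prefix code, so the decoded matrix is the one that witnesses
membership. -/
theorem flatMap_rowCode_injective :
    Function.Injective fun M : List (List Bool) => M.flatMap rowCode := by
  intro M M' h
  induction M generalizing M' with
  | nil => rcases M' with _ | ⟨l', M'⟩ <;> simp_all [rowCode]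
  | cons l M ih =>
    rcases M' with _ | ⟨l', M'⟩
    · simp [rowCode] at h
    · simp only [List.flatMap_cons] at h
      obtain ⟨rfl, h'⟩ := rowCode_append_inj h
      rw [ih h']

/-! ### The language -/

/-- The characteristic vector of a set. -/
def charVec {n : ℕ} (e : Finset (Fin n)) : List Bool := List.ofFn fun i => decide (i ∈ e)

theorem edgeCode_eq {n : ℕ} (e : Finset (Fin n)) : edgeCode e = rowCode (charVec e) := by
  simp [edgeCode, rowCode, charVec, List.map_ofFn, Function.comp_def]

theorem edgeListCode_eq {n : ℕ} (l : List (Finset (Fin n))) :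
    edgeListCode l = (l.map charVec).flatMap rowCode := by
  rw [edgeListCode, List.flatMap_map]
  exact List.flatMap_congr fun e _ => edgeCode_eq e

theorem count_ofFn {n : ℕ} (f : Fin n → Bool) :
    (List.ofFn f).count true = ∑ i, (f i).toNat := by
  induction n with
  | zero => rfl
  | succ n ih =>
    rw [List.ofFn_succ, Fin.sum_univ_succ, List.count_cons, ih]
    cases f 0 <;> simp [Nat.add_comm]

theorem eval_rowOf_ofFn {n : ℕ} (f : Fin n → Bool) (x : ℕ → Bool) :
    (rowOf (List.ofFn f)).eval x = false ↔ Odd (∑ i, (f i && x i).toNat) := by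
  induction n generalizing x with
  | zero => simp [rowOf, Row.eval]
  | succ n ih =>
    have := ih (fun i => f i.succ) fun i => x (i + 1)
    rw [List.ofFn_succ, Fin.sum_univ_succ, rowOf, Row.eval]
    simp only [Fin.val_succ, Fin.val_zero] at this ⊢
    by_cases h : (f 0 && x 0) = true
    · rw [h, Bool.toNat_true, Nat.odd_add, ← Nat.not_odd_iff_even, ← this]
      simp
    · rw [Bool.not_eq_true] at h
      rw [h, Bool.false_xor, this, Bool.toNat_false, Nat.zero_add]

theorem count_charVec {n : ℕ} (e : Finset (Fin n)) : (charVec e).count true = e.card := by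
  simp [charVec, count_ofFn, Bool.toNat, Bool.cond_decide]

theorem eval_rowOf_charVec {n : ℕ} (e : Finset (Fin n)) (x : ℕ → Bool) :
    (rowOf (charVec e)).eval x = false ↔ Odd (e.filter fun i : Fin n => x i = true).card := by
  rw [charVec, eval_rowOf_ofFn, Finset.card_filter]
  have : ∀ i : Fin n, (decide (i ∈ e) && x i).toNat =
      if i ∈ e then (if x i = true then 1 else 0) else 0 :=
    fun i => by by_cases h : i ∈ e <;> cases h' : x i <;> simp [h]
  simp [this]

theorem exists_charVec_eq {n : ℕ} {l : List Bool} (hl : l.length = n) :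
    ∃ e : Finset (Fin n), charVec e = l := by
  subst hl
  refine ⟨Finset.univ.filter fun i => l[i] = true, ?_⟩
  simp [charVec]

/-- Regular matrices are exactly the incidence matrices of scenarios, and solutions are the
assignments of `allowsQuantum_iff`. -/
theorem mem_kAllowsQuantum_two_iff (w : List (Option Bool)) :
    w ∈ kAllowsQuantum.{u} 2 ↔ ∃ M : List (List Bool), w = M.flatMap rowCode ∧
      (∀ l ∈ M, l.count true ≤ 2) ∧ Good (M.map rowOf) := by
  classical
  constructor
  · rintro ⟨n, S, l, hl, rfl, hcard, hS⟩
    obtain ⟨f, hf⟩ := (S.allowsQuantum_iff hcard).1 hS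
    refine ⟨l.map charVec, ?_, ?_, ⟨?_, ?_⟩, fun i => if h : i < n then f ⟨i, h⟩ else false, ?_⟩
    · rw [edgeListCode_eq]
    · simp only [List.forall_mem_map, count_charVec]
      exact fun e he => hcard e ((hl e).1 he)
    · simp [charVec]
    · simp only [List.map_map, List.forall_mem_map, Function.comp_apply, orig_rowOf]
      intro e he i hi
      obtain ⟨e', he', hi'⟩ := S.cover ⟨i, by simpa [charVec] using hi⟩
      refine ⟨charVec e', List.mem_map.2 ⟨e', (hl e').2 he', by simp⟩, ?_⟩
      simpa [charVec, List.getElem?_ofFn] using ⟨by simpa [charVec] using hi, hi'⟩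
    · simp only [List.forall_mem_map, eval_rowOf_charVec]
      intro e he
      simpa using hf e ((hl e).1 he)
  · rintro ⟨M, rfl, hcount, hreg, x, hx⟩
    simp only [List.map_map, Function.comp_def, orig_rowOf, List.map_id'] at hreg
    obtain ⟨n, hn, hcover⟩ : ∃ n, (∀ l ∈ M, l.length = n) ∧
        ∀ i < n, ∃ l ∈ M, l[i]? = some true := by
      rcases M with _ | ⟨l₀, M⟩
      -- Without edges there can be no vertices.
      · exact ⟨0, by simp, by simp⟩
      · exact ⟨l₀.length, fun l hl => hreg.length_eq _ hl _ (by simp), hreg.cover l₀ (by simp)⟩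
    obtain ⟨E, rfl⟩ : ∃ E : List (Finset (Fin n)), E.map charVec = M := by
      clear hreg hcount hx hcover
      induction M with
      | nil => exact ⟨[], rfl⟩
      | cons l M ih =>
        obtain ⟨E, rfl⟩ := ih fun l hl => hn l (by simp [hl])
        obtain ⟨e, rfl⟩ := exists_charVec_eq (hn l (by simp))
        exact ⟨e :: E, rfl⟩
    let S : ContextualityScenario (Fin n) :=
      { edges := E.toFinset
        cover := fun i => by
          obtain ⟨l, hl, hi⟩ := hcover i i.2
          obtain ⟨e, he, rfl⟩ := List.mem_map.1 hl
          exact ⟨e, List.mem_toFinset.2 he, by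
            simpa [charVec, List.getElem?_ofFn] using hi⟩ }
    simp only [List.forall_mem_map, count_charVec, eval_rowOf_charVec] at hcount hx
    have hcard : ∀ e ∈ S.edges, e.card ≤ 2 := fun e he => hcount e (List.mem_toFinset.1 he)
    refine ⟨n, S, E, fun e => List.mem_toFinset.symm, ?_, hcard,
      (S.allowsQuantum_iff hcard).2 ⟨fun i => x i, fun e he => ?_⟩⟩
    · rw [edgeListCode_eq]
    · convert hx e (List.mem_toFinset.1 he)

/-! ### The full run on an arbitrary word -/

theorem outputs_main (w : List (Option Bool)) (b : Bool)
    (hb : w ∈ kAllowsQuantum.{u} 2 ↔ b = true) :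
    Outputs (4 * (w.length + 1) ^ 2 + 2 * (w.length + 1)) (.scan .fresh)
      (stk w [] [] [] [] []) b := by
  classical
  have hscan := leads_scan w [] .fresh
  rw [List.append_nil] at hscan
  by_cases hw : w.foldl ScanState.next .fresh = .fresh
  · obtain ⟨M, hM, hcount⟩ := (foldl_next_eq_fresh_iff w).1 hw
    have henc : w.map inputSym = encs (M.map rowOf) := by rw [hM, map_inputSym_flatMap]
    have hlen : w.length = (encs (M.map rowOf)).length := by rw [← henc, List.length_map]
    have hback := leads_back [] (encs (M.map rowOf)).reverse [] []
    rw [List.reverse_reverse, List.append_nil, List.length_reverse, ← hlen] at hback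
    have hlead := outputs_lead (M.map rowOf)
    rw [← hlen] at hlead
    rw [hw, henc] at hscan
    have hG : decide (Good (M.map rowOf)) = b := by
      rw [mem_kAllowsQuantum_two_iff] at hb
      have hG : Good (M.map rowOf) ↔ b = true := by
        rw [← hb]
        refine ⟨fun h => ⟨M, hM, hcount, h⟩, ?_⟩
        rintro ⟨M', hM', -, h⟩
        rwa [flatMap_rowCode_injective (hM.symm.trans hM')]
      simp only [hG, Bool.decide_eq_true]
    rw [hG] at hlead
    exact (hscan.trans hback le_rfl).outputs hlead (by omega)
  · have hb' : b = false := by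
      rw [← Bool.not_eq_true, ← hb, mem_kAllowsQuantum_two_iff]
      rintro ⟨M, hM, hcount, -⟩
      exact hw ((foldl_next_eq_fresh_iff w).2 ⟨M, hM, hcount⟩)
    have hexit : (w.foldl ScanState.next .fresh).exit = .clean b := by
      rw [hb']
      cases h : w.foldl ScanState.next .fresh <;> first | rfl | exact absurd h hw
    rw [hexit] at hscan
    refine hscan.outputs (outputs_clean _ _ _) ?_
    simp
    nlinarith

/-! ### Translation to Mathlib's initial and halting configurations -/

theorem stk_initList (w : List (Option Bool)) :
    (initList machine w).stk = stk w [] [] [] [] [] := by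
  funext k
  cases k <;> rfl

theorem stk_haltList (b : Bool) : (haltList machine [b]).stk = stk [] [] [] [] [] [b] := by
  funext k
  cases k <;> rfl

theorem initList_machine (w : List (Option Bool)) : initList machine w =
    (⟨some (.scan .fresh), (none, none), stk w [] [] [] [] []⟩ :
      TM2.Cfg Alphabet Label Register) :=
  congrArg (TM2.Cfg.mk (some (Label.scan .fresh)) ((none, none) : Register)) (stk_initList w)

theorem haltList_machine (b : Bool) : haltList machine [b] =
    (⟨none, (none, none), stk [] [] [] [] [] [b]⟩ : TM2.Cfg Alphabet Label Register) :=
  congrArg (TM2.Cfg.mk (none : Option Label) ((none, none) : Register)) (stk_haltList b)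

theorem outputsInTime_of_outputs {n n' : ℕ} {w w' : List (Option Bool)} {b : Bool}
    (h : Outputs n (.scan .fresh) (stk w [] [] [] [] []) b) (hw : w' = w) (hn : n' = n) :
    Nonempty (TM2OutputsInTime machine w' (some [b]) n') := by
  subst hw hn
  obtain ⟨e⟩ := h (none, none)
  refine ⟨⟨⟨e.steps, ?_⟩, e.steps_le_m⟩⟩
  have he := e.evals_in_steps
  exact (congrArg _ (congrArg some (initList_machine w'))).trans
    (he.trans (congrArg some (haltList_machine b)).symm)

end ParityElimination

theorem mainTheorem11 : DecidableInPolyTime (kAllowsQuantum.{u} 2) := by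
  classical
  refine ⟨{ tm := ParityElimination.machine
            inputAlphabet := Equiv.refl _
            outputAlphabet := Equiv.refl _
            time := 4 * (Polynomial.X + 1) ^ 2 + 2 * (Polynomial.X + 1)
            outputsFun := fun w => ?_ }⟩
  refine Classical.choice ?_
  exact ParityElimination.outputsInTime_of_outputs
    (ParityElimination.outputs_main.{u} w _ decide_eq_true_iff.symm) (List.map_id w)
    (by simp [Computability.encodingList])
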